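/- Consider the following 1-choice process with $n\ge 1$ bins, $n$ generators and arrival rate $\lambda$. At time $0$ all bins are empty. In every round, first every non-empty bin deletes one ball; then each of the $n$ generators generates a ball with probability $\lambda$, independently of each other and of the past, and every generated ball is placed into a bin chosen independently and uniformly at random. The load of a bin at step $t$ is the number of balls it contains after $t$ rounds. Let $\log$ be the natural logarithm and, for $\lambda<1$, put $$t(n,\lambda)=\frac{9\lambda\log n}{64(1-\lambda)^2}.$$ 1. There are an absolute constant $c>0$ and a sequence $\varepsilon_n\to 0$ such that for all $n\ge 1$, all $\lambda\in[1/2,1)$ and all integers $t\ge 0$ with $|t-t(n,\lambda)|<1$ (that is, $t(n,\lambda)$ rounded to an integer in either direction), with probability at least $1-\varepsilon_n$ some bin has load at least $$c\cdot\frac{1}{1-\lambda}\log n$$ at step $t$. In particular, for every function $\lambda=\lambda(n)\in[1/2,1)$ this happens with probability $1-o(1)$. 2. Consequently, the upper bound $O\bigl(\frac{1}{1-\lambda}\log\frac{n}{1-\lambda}\bigr)$ on the maximum load of the 1-choice process is asymptotically tight for $1/2\le\lambda\le 1-1/\mathrm{poly}(n)$: for every real polynomial $p$ there are a constant $c>0$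 and a sequence $\varepsilon_n\to0$ such that for all $n\ge 1$ with $p(n)>0$, all $\lambda$ with $1/2\le\lambda\le 1-1/p(n)$ and all integers $t\ge0$ with $|t-t(n,\lambda)|<1$, with probability at least $1-\varepsilon_n$ some bin has load at least $$c\cdot\frac{1}{1-\lambda}\log\frac{n}{1-\lambda}$$ at step $t$. -/

import Mathlib

open MeasureTheory ProbabilityTheory Filter Topology

noncomputable section

namespace OneChoice

/-- The randomness of the process with `n` bins and `n` generators. For the round number `t` and
the generator `j`, the first component of `ω (t, j)` says whether generator `j` generates a ball in
that round, and the second component is the bin to which such a ball is assigned. -/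
abbrev Outcome (n : ℕ) : Type := ℕ × Fin n → Bool × Fin n

/-- The law of the process randomness for arrival rate `lam`: independently over all rounds and all
generators, a ball is generated with probability `lam`, and independently of this the bin is
uniformly distributed over all `n` bins. -/
def law (n : ℕ) (lam : unitInterval) : Measure (Outcome n) :=
  Measure.infinitePi fun _ : ℕ × Fin n =>
    (bernoulliMeasure true false lam).prod (uniformOn (Set.univ : Set (Fin n)))

/-- The number of balls that bin `i` receives in the round numbered `t`. -/
def received {n : ℕ} (ω : Outcome n) (t : ℕ) (i : Fin n) : ℕ :=
  (Finset.univ.filter fun j : Fin n => ω (t, j) = (true, i)).card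

/-- The load of every bin of the 1-choice process after the given number of rounds. Initially all
bins are empty; in every round each non-empty bin first deletes one ball (the subtraction is that of
natural numbers, so empty bins stay empty) and then the newly generated balls are added. -/
def load {n : ℕ} (ω : Outcome n) : ℕ → Fin n → ℕ
  | 0 => fun _ => 0
  | t + 1 => fun i => (load ω t i - 1) + received ω t i

/-- The (real) number `9 λ log n / (64 (1 - λ)²)`. -/
def criticalTime (n : ℕ) (lam : ℝ) : ℝ :=
  9 * lam * Real.log n / (64 * (1 - lam) ^ 2)

end OneChoice

end

namespace OneChoice

/-! A bin loses at most one ball per round, so it suffices that some bin receives t + Ω(log n / d)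
balls in t rounds, where d = 1 - λ. Plant a heavy bin: choose a bin uniformly and tilt every
coordinate towards it so that, for large n, its mean intake per round rises from λ to at least 1 +
d/2. Its intake then exceeds t by order td, that is, by order log n / d.

The planted law has density `mixture`. Its chi-square distance from the true law is at most n⁻¹
exp(4td²/λ), about n^(-7/16) at the critical time, so the two laws nearly agree and the true law
also has a heavy bin with high probability. `integral_mixture_sq_le` bounds the distance,
`le_prob_exists_hits` transfers the event, and `exp_mul_pow_le` is the Chernoff estimate for the
planted bin.

For the second claim, 1/(1 - λ) is polynomially bounded, so log(n/(1 - λ)) = O(log n). -/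

/-- The law of a single coordinate of the process randomness. -/
noncomputable abbrev coordLaw (n : ℕ) (lam : unitInterval) : Measure (Bool × Fin n) :=
  (bernoulliMeasure true false lam).prod (uniformOn (Set.univ : Set (Fin n)))

/-- The number (zero or one) of balls that a generator sends to bin `i` in one round. -/
noncomputable def hit {n : ℕ} (i : Fin n) (z : Bool × Fin n) : ℝ := if z = (true, i) then 1 else 0

lemma hit_mul_self {n : ℕ} (i : Fin n) (z : Bool × Fin n) : hit i z * hit i z = hit i z := by
  simp [hit]

lemma hit_mul_of_ne {n : ℕ} {i j : Fin n} (hij : i ≠ j) (z : Bool × Fin n) : hit i z * hit j z = 0 := by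
  simp only [hit]
  split_ifs <;> simp_all

/-- Each round deletes at most one ball; truncated subtraction only helps. -/
lemma sum_hit_le_load {n : ℕ} (ω : Outcome n) (t : ℕ) (i : Fin n) :
    ∑ a ∈ Finset.range t ×ˢ Finset.univ, hit i (ω a) ≤ (load ω t i : ℝ) + t := by
  rw [Finset.sum_product]
  induction t with
  | zero => simp [load]
  | succ t ih =>
    rw [Finset.sum_range_succ]
    have h1 : ∑ j, hit i (ω (t, j)) = (received ω t i : ℝ) := by
      simp [hit, received]
    have h2 : (load ω t i : ℝ) ≤ ((load ω t i - 1 : ℕ) : ℝ) + 1 := by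
      exact_mod_cast (by omega : load ω t i ≤ load ω t i - 1 + 1)
    simp only [load]
    push_cast
    linarith

/-! ### Tilted densities and their mixture -/

/-- The one-coordinate likelihood ratio of the law tilted towards bin `i`. -/
noncomputable def tilt {n : ℕ} (lam : unitInterval) (α : ℝ) (i : Fin n) (z : Bool × Fin n) : ℝ :=
  1 - α * ((lam : ℝ) / n) + α * hit i z

lemma tilt_nonneg {n : ℕ} (lam : unitInterval) {α : ℝ} (hα : 0 ≤ α) (hα1 : α * ((lam : ℝ) / n) ≤ 1) (i : Fin n)
    (z : Bool × Fin n) : 0 ≤ tilt lam α i z := by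
  have : 0 ≤ hit i z := by unfold hit; split_ifs <;> norm_num
  unfold tilt
  nlinarith [mul_nonneg hα this]

/-- The likelihood ratio of the process law and the mixture, over the bins, of the laws in which
the coordinates in `s` are tilted towards that bin. -/
noncomputable def mixture {n : ℕ} (lam : unitInterval) (α : ℝ) (s : Finset (ℕ × Fin n))
    (ω : Outcome n) : ℝ :=
  (n : ℝ)⁻¹ * ∑ i, ∏ a ∈ s, tilt lam α i (ω a)

lemma mixture_sq {n : ℕ} (lam : unitInterval) (α : ℝ) (s : Finset (ℕ × Fin n)) (ω : Outcome n) :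
    mixture lam α s ω ^ 2 =
      ((n : ℝ)⁻¹) ^ 2 * ∑ i, ∑ j, ∏ a ∈ s, (tilt lam α i (ω a) * tilt lam α j (ω a)) := by
  unfold mixture
  rw [mul_pow, sq (∑ i, _), Finset.sum_mul_sum]
  simp_rw [Finset.prod_mul_distrib]

instance isProbabilityMeasure_coordLaw (n : ℕ) [NeZero n] (lam : unitInterval) :
    IsProbabilityMeasure (coordLaw n lam) := by
  have : IsProbabilityMeasure (uniformOn (Set.univ : Set (Fin n))) :=
    isProbabilityMeasure_uniformOn Set.finite_univ Set.univ_nonempty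
  infer_instance

instance isProbabilityMeasure_law (n : ℕ) [NeZero n] (lam : unitInterval) :
    IsProbabilityMeasure (law n lam) := by
  unfold law
  infer_instance

/-! ### Moments of the mixture and transfer of the event -/

section Integrals

variable {n : ℕ} [NeZero n] (lam : unitInterval)

lemma integrable_prod (s : Finset (ℕ × Fin n)) (h : Bool × Fin n → ℝ) :
    Integrable (fun ω : Outcome n => ∏ a ∈ s, h (ω a)) (law n lam) := by
  obtain ⟨C, hC⟩ := (Set.finite_range fun z => ‖h z‖).bddAbove
  have hm : Measurable fun ω : Outcome n => ∏ a ∈ s, h (ω a) :=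
    Finset.measurable_prod _ fun a _ => (measurable_of_countable h).comp (measurable_pi_apply a)
  refine Integrable.of_bound hm.aestronglyMeasurable (C ^ s.card) (ae_of_all _ fun ω => ?_)
  rw [norm_prod]
  exact (Finset.prod_le_prod (fun a _ => norm_nonneg _) fun a _ => hC ⟨ω a, rfl⟩).trans_eq
    (Finset.prod_const C)

lemma integral_prod (s : Finset (ℕ × Fin n)) (h : Bool × Fin n → ℝ) :
    ∫ ω : Outcome n, ∏ a ∈ s, h (ω a) ∂(law n lam) = (∫ z, h z ∂(coordLaw n lam)) ^ s.card := by
  have key := integral_restrict_infinitePi (μ := fun _ : ℕ × Fin n => coordLaw n lam) (s := s)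
    (f := fun x => ∏ a, h (x a))
    (measurable_of_countable _).aestronglyMeasurable
  rw [integral_fintype_prod_eq_prod (fun _ : s => h)] at key
  simp only [Finset.prod_const, Finset.card_univ, Fintype.card_coe] at key
  rw [← key]
  refine integral_congr_ae (ae_of_all _ fun ω => ?_)
  exact (Finset.prod_coe_sort s fun a => h (ω a)).symm

lemma integral_affine_hit (i : Fin n) (a b : ℝ) :
    ∫ z, (a + b * hit i z) ∂(coordLaw n lam) = a + b * ((lam : ℝ) / n) := by
  have hhit : ∫ z, hit i z ∂(coordLaw n lam) = (lam : ℝ) / n := by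
    have h1 : (hit i : Bool × Fin n → ℝ) = Set.indicator ({true} ×ˢ {i}) 1 := by
      ext z
      simp [hit, Set.indicator, Prod.ext_iff]
    rw [h1, integral_indicator_one (Set.toFinite _).measurableSet, measureReal_prod_prod]
    rw [bernoulliMeasure_real_apply_of_mem_of_notMem _ (by measurability) (by simp) (by simp)]
    simp [measureReal_def, uniformOn_univ, div_eq_mul_inv]
  rw [integral_add (by simp) (Integrable.of_finite), integral_const_mul, hhit]
  simp

lemma integral_affine_hit_two (i j : Fin n) (a b c : ℝ) :
    ∫ z, (a + b * hit i z + c * hit j z) ∂(coordLaw n lam) =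
      a + b * ((lam : ℝ) / n) + c * ((lam : ℝ) / n) := by
  rw [integral_add Integrable.of_finite Integrable.of_finite, integral_affine_hit]
  have := integral_affine_hit lam j 0 c
  simp only [zero_add] at this
  rw [this]

lemma integral_tilt (α : ℝ) (i : Fin n) : ∫ z, tilt lam α i z ∂(coordLaw n lam) = 1 := by
  unfold tilt
  rw [integral_affine_hit]
  ring

lemma integral_tilt_sq (α : ℝ) (i : Fin n) :
    ∫ z, tilt lam α i z * tilt lam α i z ∂(coordLaw n lam) =
      1 + α ^ 2 * ((lam : ℝ) / n * (1 - (lam : ℝ) / n)) := by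
  have h : ∀ z, tilt lam α i z * tilt lam α i z = (1 - α * ((lam : ℝ) / n)) ^ 2 +
      (2 * α * (1 - α * ((lam : ℝ) / n)) + α ^ 2) * hit i z := fun z => by
    unfold tilt
    linear_combination α ^ 2 * hit_mul_self i z
  simp_rw [h]
  rw [integral_affine_hit]
  ring

lemma integral_tilt_mul_of_ne (α : ℝ) {i j : Fin n} (hij : i ≠ j) :
    ∫ z, tilt lam α i z * tilt lam α j z ∂(coordLaw n lam) =
      1 - (α * ((lam : ℝ) / n)) ^ 2 := by
  have h : ∀ z, tilt lam α i z * tilt lam α j z = (1 - α * ((lam : ℝ) / n)) ^ 2 +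
      (α * (1 - α * ((lam : ℝ) / n))) * hit i z + (α * (1 - α * ((lam : ℝ) / n))) * hit j z :=
    fun z => by
    unfold tilt
    linear_combination α ^ 2 * hit_mul_of_ne hij z
  simp_rw [h]
  rw [integral_affine_hit_two]
  ring

/-- Laplace transform under the tilted law, where with p = λ/n a hit has probability p(1 + α(1 -
p)). -/
lemma integral_exp_hit_mul_tilt (α r : ℝ) (i : Fin n) :
    ∫ z, Real.exp (-r * hit i z) * tilt lam α i z ∂(coordLaw n lam) =
      1 - (lam : ℝ) / n * (1 + α * (1 - (lam : ℝ) / n)) * (1 - Real.exp (-r)) := by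
  have h : ∀ z, Real.exp (-r * hit i z) * tilt lam α i z = (1 - α * ((lam : ℝ) / n)) +
      (Real.exp (-r) * (1 - α * ((lam : ℝ) / n) + α) - (1 - α * ((lam : ℝ) / n))) * hit i z :=
    fun z => by
    unfold tilt hit
    split_ifs <;> simp
  simp_rw [h]
  rw [integral_affine_hit]
  ring

lemma integrable_mixture (α : ℝ) (s : Finset (ℕ × Fin n)) :
    Integrable (mixture lam α s) (law n lam) :=
  (integrable_finsetSum _ fun _ _ => integrable_prod lam s _).const_mul _

lemma integral_mixture (α : ℝ) (s : Finset (ℕ × Fin n)) :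
    ∫ ω, mixture lam α s ω ∂(law n lam) = 1 := by
  unfold mixture
  rw [integral_const_mul, integral_finsetSum _ fun _ _ => integrable_prod lam s _]
  simp_rw [integral_prod, integral_tilt]
  simp [NeZero.ne n]

lemma integrable_mixture_sq (α : ℝ) (s : Finset (ℕ × Fin n)) :
    Integrable (fun ω => mixture lam α s ω ^ 2) (law n lam) := by
  simp_rw [mixture_sq]
  exact (integrable_finsetSum _ fun i _ => integrable_finsetSum _ fun j _ =>
    integrable_prod lam s fun z => tilt lam α i z * tilt lam α j z).const_mul _

/-- A ball cannot enter two bins, so tilts towards distinct bins are negatively correlated and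
contribute at most 1. Only the n diagonal pairs out of n² carry the growing factor. -/
lemma integral_mixture_sq_le {α : ℝ} (hα : 0 ≤ α) (hα1 : α * ((lam : ℝ) / n) ≤ 1)
    (s : Finset (ℕ × Fin n)) :
    ∫ ω, mixture lam α s ω ^ 2 ∂(law n lam) ≤
      1 + (n : ℝ)⁻¹ * (1 + α ^ 2 * ((lam : ℝ) / n * (1 - (lam : ℝ) / n))) ^ s.card := by
  have hn : (0 : ℝ) < n := by exact_mod_cast NeZero.pos n
  have hp : 0 ≤ α * ((lam : ℝ) / n) := mul_nonneg hα (div_nonneg lam.2.1 hn.le)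
  simp_rw [mixture_sq]
  rw [integral_const_mul, integral_finsetSum _ fun i _ => integrable_finsetSum _ fun j _ =>
    integrable_prod lam s fun z => tilt lam α i z * tilt lam α j z]
  set B := (1 + α ^ 2 * ((lam : ℝ) / n * (1 - (lam : ℝ) / n))) ^ s.card with hB
  have hterm : ∀ i j : Fin n, ∫ ω, ∏ a ∈ s, (tilt lam α i (ω a) * tilt lam α j (ω a)) ∂(law n lam)
      ≤ 1 + if i = j then B else 0 := fun i j => by
    rw [integral_prod lam s fun z => tilt lam α i z * tilt lam α j z]
    split_ifs with hij
    · subst hij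
      rw [integral_tilt_sq]
      linarith
    · rw [integral_tilt_mul_of_ne lam α hij, add_zero]
      exact pow_le_one₀ (by nlinarith) (by nlinarith [sq_nonneg (α * ((lam : ℝ) / n))])
  calc _ ≤ ((n : ℝ)⁻¹) ^ 2 * ∑ i : Fin n, ∑ j : Fin n, (1 + if i = j then B else 0) := by
        gcongr with i
        rw [integral_finsetSum _ fun j _ =>
          integrable_prod lam s fun z => tilt lam α i z * tilt lam α j z]
        exact Finset.sum_le_sum fun j _ => hterm i j
    _ = 1 + (n : ℝ)⁻¹ * B := by
        simp [Finset.sum_add_distrib]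
        field_simp

/-- With M the mixture density, write 1 = (1 - M) + M off the event. The first term is controlled by
the variance of M, the second by a Chernoff bound under the planted law. -/
lemma le_prob_exists_hits {α r m c : ℝ} (hα : 0 ≤ α) (hα1 : α * ((lam : ℝ) / n) ≤ 1)
    (hr : 0 ≤ r) (hc : 0 < c) (s : Finset (ℕ × Fin n))
    (hV : (n : ℝ)⁻¹ * (1 + α ^ 2 * ((lam : ℝ) / n * (1 - (lam : ℝ) / n))) ^ s.card ≤ c ^ 2) :
    1 - (c + Real.exp (r * m) *
        (1 - (lam : ℝ) / n * (1 + α * (1 - (lam : ℝ) / n)) * (1 - Real.exp (-r))) ^ s.card) ≤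
      (law n lam).real {ω | ∃ i, m ≤ ∑ a ∈ s, hit i (ω a)} := by
  set A : Set (Outcome n) := {ω | ∃ i, m ≤ ∑ a ∈ s, hit i (ω a)}
  set q := (1 - (lam : ℝ) / n * (1 + α * (1 - (lam : ℝ) / n)) * (1 - Real.exp (-r))) ^ s.card
    with hq
  set g : Outcome n → ℝ := fun ω =>
    Real.exp (r * m) * ((n : ℝ)⁻¹ * ∑ i, ∏ a ∈ s, (Real.exp (-r * hit i (ω a)) * tilt lam α i (ω a)))
    with hg
  set f : Outcome n → ℝ := fun ω =>
    (c / 2 + (2 * c)⁻¹ * (mixture lam α s ω ^ 2 - 2 * mixture lam α s ω + 1)) + g ω with hf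
  have hgi : Integrable g (law n lam) := ((integrable_finsetSum _ fun i _ =>
    integrable_prod lam s fun z => Real.exp (-r * hit i z) * tilt lam α i z).const_mul _).const_mul _
  have hmi1 : Integrable (fun ω => mixture lam α s ω ^ 2 - 2 * mixture lam α s ω) (law n lam) :=
    (integrable_mixture_sq lam α s).sub ((integrable_mixture lam α s).const_mul 2)
  have hmi : Integrable (fun ω => mixture lam α s ω ^ 2 - 2 * mixture lam α s ω + 1)
      (law n lam) := hmi1.add (integrable_const 1)
  have hfi1 : Integrable (fun ω => c / 2 + (2 * c)⁻¹ *
      (mixture lam α s ω ^ 2 - 2 * mixture lam α s ω + 1)) (law n lam) :=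
    (integrable_const _).add (hmi.const_mul _)
  have hfi : Integrable f (law n lam) := hfi1.add hgi
  have hg0 : ∀ ω, 0 ≤ g ω := fun ω => by
    have := fun i a => tilt_nonneg lam hα hα1 i (ω a)
    have h2 : 0 ≤ ∑ i, ∏ a ∈ s, (Real.exp (-r * hit i (ω a)) * tilt lam α i (ω a)) :=
      Finset.sum_nonneg fun i _ => Finset.prod_nonneg fun a _ =>
        mul_nonneg (Real.exp_pos _).le (this i a)
    positivity
  have hf0 : ∀ ω, 0 ≤ f ω := fun ω => by
    have h1 : mixture lam α s ω ^ 2 - 2 * mixture lam α s ω + 1 = (mixture lam α s ω - 1) ^ 2 := by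
      ring
    have := hg0 ω
    simp only [hf, h1]
    positivity
  have hsub : Aᶜ ⊆ {ω | 1 ≤ f ω} := fun ω hω => by
    have hlt : ∀ i, ∑ a ∈ s, hit i (ω a) < m := by simpa [A] using hω
    -- Every bin has fewer than m hits here, so each summand may be multiplied by exp(r(m - hits)) ≥
    -- 1.
    have h1 : mixture lam α s ω ≤ g ω := by
      simp only [mixture, hg]
      rw [mul_left_comm, Finset.mul_sum _ _ (Real.exp (r * m))]
      refine mul_le_mul_of_nonneg_left (Finset.sum_le_sum fun i _ => ?_)
        (inv_nonneg.2 n.cast_nonneg)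
      rw [Finset.prod_mul_distrib, ← Real.exp_sum, ← mul_assoc, ← Real.exp_add, ← Finset.mul_sum]
      refine le_mul_of_one_le_left
        (Finset.prod_nonneg fun a _ => tilt_nonneg lam hα hα1 i (ω a)) (Real.one_le_exp ?_)
      nlinarith [hlt i]
    -- AM-GM with weight c; as the variance is at most c², both halves integrate to at most c/2.
    have h2 : 1 - mixture lam α s ω ≤
        c / 2 + (2 * c)⁻¹ * (mixture lam α s ω ^ 2 - 2 * mixture lam α s ω + 1) := by
      rw [← sub_nonneg]
      have : c / 2 + (2 * c)⁻¹ * (mixture lam α s ω ^ 2 - 2 * mixture lam α s ω + 1) -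
          (1 - mixture lam α s ω) = (2 * c)⁻¹ * (c - (1 - mixture lam α s ω)) ^ 2 := by
        field_simp
        ring
      rw [this]
      positivity
    simp only [Set.mem_ofPred_eq, hf]
    linarith
  have hgint : ∫ ω, g ω ∂(law n lam) = Real.exp (r * m) * q := by
    simp only [hg]
    rw [integral_const_mul, integral_const_mul, integral_finsetSum _ fun i _ =>
      integrable_prod lam s fun z => Real.exp (-r * hit i z) * tilt lam α i z]
    have h1 : ∀ i : Fin n, ∫ ω, ∏ a ∈ s, (Real.exp (-r * hit i (ω a)) * tilt lam α i (ω a))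
        ∂(law n lam) = q := fun i => by
      rw [integral_prod lam s fun z => Real.exp (-r * hit i z) * tilt lam α i z,
        integral_exp_hit_mul_tilt]
    simp_rw [h1]
    simp [NeZero.ne n]
  have hfint : ∫ ω, f ω ∂(law n lam) ≤ c + Real.exp (r * m) * q := by
    simp only [hf]
    rw [integral_add hfi1 hgi, hgint, integral_add (integrable_const _) (hmi.const_mul _),
      integral_const_mul, integral_add hmi1 (integrable_const _), integral_sub
        (integrable_mixture_sq lam α s) ((integrable_mixture lam α s).const_mul 2),
      integral_const_mul, integral_mixture]
    have h1 := (integral_mixture_sq_le lam hα hα1 s).trans (add_le_add_right hV 1)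
    have h2 : (2 * c)⁻¹ * (∫ ω, mixture lam α s ω ^ 2 ∂(law n lam) - 2 * 1 + 1) ≤
        (2 * c)⁻¹ * c ^ 2 := by
      gcongr
      linarith
    have h3 : (2 * c)⁻¹ * c ^ 2 = c / 2 := by field_simp
    simp only [integral_const, probReal_univ, one_smul]
    linarith
  have hmarkov := mul_meas_ge_le_integral_of_nonneg (ae_of_all _ hf0) hfi 1
  have h1 : (law n lam).real Aᶜ ≤ c + Real.exp (r * m) * q := by
    have := measureReal_mono (μ := law n lam) hsub
    linarith
  have h2 := measureReal_union_le (μ := law n lam) A Aᶜ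
  rw [Set.union_compl_self, probReal_univ] at h2
  linarith

end Integrals


/-! ### Numerical estimates at the critical time -/

lemma sub_sq_le_one_sub_exp_neg {r : ℝ} (hr : 0 ≤ r) : r - r ^ 2 ≤ 1 - Real.exp (-r) := by
  have h1 : Real.exp (-r) ≤ (1 + r)⁻¹ := by
    rw [Real.exp_neg]
    exact inv_anti₀ (by linarith) (by linarith [Real.add_one_le_exp r])
  have h2 : (1 + r)⁻¹ ≤ 1 - r + r ^ 2 := by
    rw [inv_le_iff_one_le_mul₀ (by linarith)]
    nlinarith [pow_nonneg hr 3]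
  linarith

/-- An upper bound for the probability that no bin has load at least `log n / (128 (1 - λ))` at the
critical time; it decays polynomially in the number `n` of bins. -/
noncomputable def failureBound (n : ℕ) : ℝ :=
  if 32 ≤ Real.log n then Real.exp (1 - 7 / 32 * Real.log n) + Real.exp (-(Real.log n / 1024))
  else 1

lemma tendsto_log_natCast_atTop : Tendsto (fun n : ℕ => Real.log n) atTop atTop :=
  Real.tendsto_log_atTop.comp tendsto_natCast_atTop_atTop

lemma tendsto_failureBound : Tendsto failureBound atTop (𝓝 0) := by
  have hL := tendsto_log_natCast_atTop
  have h1 : Tendsto (fun n : ℕ => Real.exp (1 - 7 / 32 * Real.log n)) atTop (𝓝 0) := by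
    refine Real.tendsto_exp_atBot.comp ?_
    simp_rw [sub_eq_add_neg]
    exact tendsto_atBot_add_const_left _ _
      (tendsto_neg_atTop_atBot.comp (hL.const_mul_atTop (by norm_num)))
  have h2 : Tendsto (fun n : ℕ => Real.exp (-(Real.log n / 1024))) atTop (𝓝 0) :=
    Real.tendsto_exp_atBot.comp
      (tendsto_neg_atTop_atBot.comp (hL.atTop_div_const (by norm_num)))
  have h3 := h1.add h2
  rw [add_zero] at h3
  refine h3.congr' ?_
  filter_upwards [hL.eventually_ge_atTop 32] with n hn
  simp [failureBound, hn]

lemma exp_mul_pow_le {n t : ℕ} {L l d : ℝ} (hd : d = 1 - l) (hd0 : 0 < d) (hd2 : d ≤ 1 / 2)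
    (hlpos : 0 < l) (hp0 : 0 ≤ l / n) (hp4 : l / n ≤ 1 / 4) (hα0 : 0 ≤ 2 * d / l)
    (hα2 : 2 * d / l ≤ 2) (hnpos : (0 : ℝ) < n) (htd : L / 16 ≤ t * d ^ 2) :
    Real.exp (d / 4 * (t + 1 / 128 * (1 / d * L))) *
      (1 - l / n * (1 + 2 * d / l * (1 - l / n)) * (1 - Real.exp (-(d / 4)))) ^ (t * n) ≤
      Real.exp (-(L / 1024)) := by
  have ht0 : (0 : ℝ) ≤ t := t.cast_nonneg
  set p' := l / n * (1 + 2 * d / l * (1 - l / n)) with hp'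
  have hp'0 : 0 ≤ p' := mul_nonneg hp0 (by nlinarith)
  have hp'1 : p' ≤ 1 := by
    have : 1 + 2 * d / l * (1 - l / n) ≤ 3 := by nlinarith
    calc p' ≤ 1 / 4 * 3 := mul_le_mul hp4 this (by nlinarith) (by norm_num)
      _ ≤ 1 := by norm_num
  have he0 : 0 ≤ 1 - Real.exp (-(d / 4)) := by
    have := Real.exp_le_one_iff.2 (by linarith : -(d / 4) ≤ 0)
    linarith
  have he1 : 1 - Real.exp (-(d / 4)) ≤ 1 := by linarith [Real.exp_pos (-(d / 4))]
  have h0 : 0 ≤ 1 - p' * (1 - Real.exp (-(d / 4))) := by nlinarith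
  have h1 := pow_le_pow_left₀ h0 (Real.one_sub_le_exp_neg (p' * (1 - Real.exp (-(d / 4)))))
    (t * n)
  rw [← Real.exp_nat_mul] at h1
  refine (mul_le_mul_of_nonneg_left h1 (Real.exp_pos _).le).trans ?_
  rw [← Real.exp_add, Real.exp_le_exp]
  have h2 : ((t * n : ℕ) : ℝ) * p' = t * (l + 2 * d * (1 - l / n)) := by
    rw [hp']
    push_cast
    field_simp
  -- As l/n ≤ 1/4, the planted mean per round is at least l + 3d/2 = 1 + d/2.
  have h3 : t * (1 + d / 2) ≤ ((t * n : ℕ) : ℝ) * p' := by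
    rw [h2]
    refine mul_le_mul_of_nonneg_left ?_ ht0
    nlinarith [mul_nonneg hd0.le (sub_nonneg.2 hp4)]
  have h4 := sub_sq_le_one_sub_exp_neg (r := d / 4) (by linarith)
  have h5 : t * (1 + d / 2) * (d / 4 - (d / 4) ^ 2) ≤
      ((t * n : ℕ) : ℝ) * p' * (1 - Real.exp (-(d / 4))) :=
    mul_le_mul h3 h4 (by nlinarith) (mul_nonneg (Nat.cast_nonneg _) hp'0)
  have h6 : d / 4 * (t + 1 / 128 * (1 / d * L)) = d * t / 4 + L / 512 := by
    field_simp
    ring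
  rw [h6]
  have h7 : t * (1 + d / 2) * (d / 4 - (d / 4) ^ 2) =
      d * t / 4 + t * d ^ 2 * (1 / 16 - d / 32) := by ring
  -- Since d ≤ 1/2, the gain is at least (3/64)(L/16) = 3L/1024, against a cost of L/512.
  nlinarith [mul_nonneg ht0 (sq_nonneg d)]

lemma le_prob_exists_heavy_of_log_ge {n : ℕ} {lam : unitInterval} {t : ℕ}
    (hL : 32 ≤ Real.log n) (hlam : (1 / 2 : ℝ) ≤ lam) (hlam1 : (lam : ℝ) < 1)
    (ht : |(t : ℝ) - criticalTime n lam| < 1) :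
    1 - (Real.exp (1 - 7 / 32 * Real.log n) + Real.exp (-(Real.log n / 1024))) ≤
      (law n lam).real
        {ω | ∃ i, 1 / 128 * (1 / (1 - (lam : ℝ)) * Real.log n) ≤ (load ω t i : ℝ)} := by
  have hn0 : n ≠ 0 := by
    rintro rfl
    norm_num at hL
  have : NeZero n := ⟨hn0⟩
  have hnpos : (0 : ℝ) < n := by exact_mod_cast Nat.pos_of_ne_zero hn0
  have hn4 : (4 : ℝ) ≤ n := by linarith [Real.log_le_sub_one_of_pos hnpos]
  set L := Real.log n with hLdef
  have hexpL : (n : ℝ)⁻¹ = Real.exp (-L) := by rw [Real.exp_neg, Real.exp_log hnpos]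
  obtain ⟨l, hl⟩ : ∃ l : ℝ, l = (lam : ℝ) := ⟨_, rfl⟩
  rw [← hl] at hlam hlam1 ht ⊢
  obtain ⟨d, hd⟩ : ∃ d : ℝ, d = 1 - l := ⟨_, rfl⟩
  rw [← hd]
  have hd0 : 0 < d := by linarith
  have hd2 : d ≤ 1 / 2 := by linarith
  have hlpos : 0 < l := by linarith
  rw [criticalTime, ← hLdef, ← hd, abs_lt] at ht
  obtain ⟨ht1, ht2⟩ := ht
  have hT : 9 * l * L / (64 * d ^ 2) * d ^ 2 = 9 * l * L / 64 := by field_simp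
  -- Rounding costs at most d² ≤ 1/4, and 9L/128 - 1/4 ≥ L/16 is exactly L ≥ 32.
  have htd : L / 16 ≤ t * d ^ 2 := by nlinarith
  have htd' : t * d ^ 2 ≤ 9 * l * L / 64 + d ^ 2 := by nlinarith
  have ht0 : (0 : ℝ) ≤ t := t.cast_nonneg
  have hp0 : 0 ≤ l / n := by positivity
  have hp4 : l / n ≤ 1 / 4 := by
    rw [div_le_iff₀ hnpos]
    linarith
  have hα2 : 2 * d / l ≤ 2 := by
    rw [div_le_iff₀ hlpos]
    linarith
  have hα0 : 0 ≤ 2 * d / l := by positivity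
  have hcard : (Finset.range t ×ˢ (Finset.univ : Finset (Fin n))).card = t * n := by simp
  have hV : (n : ℝ)⁻¹ * (1 + (2 * d / l) ^ 2 * (l / n * (1 - l / n))) ^ (t * n) ≤
      Real.exp (1 - 7 / 32 * L) ^ 2 := by
    have h1 : 1 + (2 * d / l) ^ 2 * (l / n * (1 - l / n)) ≤ Real.exp (4 * d ^ 2 / (l * n)) := by
      have h2 : (2 * d / l) ^ 2 * (l / n * (1 - l / n)) ≤ (2 * d / l) ^ 2 * (l / n) := by
        gcongr
        nlinarith
      have h3 : (2 * d / l) ^ 2 * (l / n) = 4 * d ^ 2 / (l * n) := by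
        field_simp
        ring
      linarith [Real.add_one_le_exp (4 * d ^ 2 / (l * n))]
    have h0 : 0 ≤ 1 + (2 * d / l) ^ 2 * (l / n * (1 - l / n)) := by
      have : 0 ≤ (2 * d / l) ^ 2 * (l / n * (1 - l / n)) :=
        mul_nonneg (sq_nonneg _) (mul_nonneg hp0 (by linarith))
      linarith
    have h4 := pow_le_pow_left₀ h0 h1 (t * n)
    rw [← Real.exp_nat_mul] at h4
    rw [hexpL, ← Real.exp_nat_mul]
    refine (mul_le_mul_of_nonneg_left h4 (Real.exp_pos _).le).trans ?_
    rw [← Real.exp_add, Real.exp_le_exp]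
    have h5 : ((t * n : ℕ) : ℝ) * (4 * d ^ 2 / (l * n)) = 4 * (t * d ^ 2) / l := by
      push_cast
      field_simp
    -- The 2 absorbs rounding: 4d²/l ≤ 2. With n⁻¹ = exp(-L) this leaves exp(2 - 7L/16), the square
    -- of c.
    have h6 : 4 * (t * d ^ 2) / l ≤ 9 / 16 * L + 2 := by
      rw [div_le_iff₀ hlpos]
      nlinarith
    rw [h5]
    push_cast
    linarith
  have hQ : Real.exp (d / 4 * (t + 1 / 128 * (1 / d * L))) *
      (1 - l / n * (1 + 2 * d / l * (1 - l / n)) * (1 - Real.exp (-(d / 4)))) ^ (t * n) ≤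
      Real.exp (-(L / 1024)) := by
    exact exp_mul_pow_le hd hd0 hd2 hlpos hp0 hp4 hα0 hα2 hnpos htd
  have key := le_prob_exists_hits (n := n) lam (α := 2 * d / l) (r := d / 4)
    (m := t + 1 / 128 * (1 / d * L)) (c := Real.exp (1 - 7 / 32 * L)) hα0
    (by rw [← hl]; nlinarith) (by linarith) (Real.exp_pos _) (Finset.range t ×ˢ Finset.univ)
    (by rw [hcard, ← hl]; exact hV)
  rw [hcard, ← hl] at key
  refine le_trans (by linarith) (key.trans (measureReal_mono ?_))
  rintro ω ⟨i, hi⟩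
  exact ⟨i, by linarith [sum_hit_le_load ω t i]⟩

lemma le_prob_exists_heavy {n : ℕ} {lam : unitInterval} {t : ℕ}
    (hlam : (1 / 2 : ℝ) ≤ lam) (hlam1 : (lam : ℝ) < 1)
    (ht : |(t : ℝ) - criticalTime n lam| < 1) :
    1 - failureBound n ≤ (law n lam).real
        {ω | ∃ i, 1 / 128 * (1 / (1 - (lam : ℝ)) * Real.log n) ≤ (load ω t i : ℝ)} := by
  unfold failureBound
  split_ifs with hL
  · exact le_prob_exists_heavy_of_log_ge hL hlam hlam1 ht
  · simp

/-! ### Comparing log(n/(1 - λ)) with log n -/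

lemma eventually_log_div_le (p : Polynomial ℝ) :
    ∀ᶠ n : ℕ in atTop, ∀ x : ℝ, 0 < x → x⁻¹ ≤ p.eval (n : ℝ) →
      Real.log (n / x) ≤ (p.natDegree + 2) * Real.log n := by
  have hO : (fun x : ℝ => p.eval x) =o[atTop] fun x => x ^ (p.natDegree + 1) := by
    have h1 := p.isBigO_atTop_of_degree_le (Polynomial.X ^ p.natDegree) (by
      rw [Polynomial.degree_X_pow]
      exact Polynomial.degree_le_natDegree)
    simp only [Polynomial.eval_pow, Polynomial.eval_X] at h1
    exact h1.trans_isLittleO (Asymptotics.isLittleO_pow_pow_atTop_of_lt (Nat.lt_succ_self _))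
  filter_upwards [tendsto_natCast_atTop_atTop.eventually (hO.bound one_pos),
    eventually_ge_atTop 1] with n hn hn1 x hx hxp
  have hn0 : (0 : ℝ) < n := by exact_mod_cast hn1
  have h1 : x⁻¹ ≤ (n : ℝ) ^ (p.natDegree + 1) := by
    refine hxp.trans ((le_abs_self _).trans ?_)
    simpa [abs_of_pos hn0] using hn
  have h2 : (n : ℝ) / x ≤ (n : ℝ) ^ (p.natDegree + 2) := by
    rw [div_eq_mul_inv, pow_succ' _ (p.natDegree + 1)]
    gcongr
  have h3 := Real.log_le_log (by positivity) h2
  rw [Real.log_pow] at h3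
  exact_mod_cast h3

end OneChoice

theorem mainTheorem6 :
    (∃ c : ℝ, 0 < c ∧ ∃ ε : ℕ → ℝ, Tendsto ε atTop (𝓝 0) ∧
      ∀ (n : ℕ) (lam : unitInterval) (t : ℕ), 1 ≤ n →
        (1 / 2 : ℝ) ≤ (lam : ℝ) → (lam : ℝ) < 1 →
        |(t : ℝ) - OneChoice.criticalTime n lam| < 1 →
          1 - ε n ≤ (OneChoice.law n lam).real
            {ω | ∃ i : Fin n,
              c * (1 / (1 - (lam : ℝ)) * Real.log n) ≤ (OneChoice.load ω t i : ℝ)}) ∧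
    (∀ p : Polynomial ℝ,
      ∃ c : ℝ, 0 < c ∧ ∃ ε : ℕ → ℝ, Tendsto ε atTop (𝓝 0) ∧
      ∀ (n : ℕ) (lam : unitInterval) (t : ℕ), 1 ≤ n →
        0 < p.eval (n : ℝ) →
        (1 / 2 : ℝ) ≤ (lam : ℝ) → (lam : ℝ) ≤ 1 - 1 / p.eval (n : ℝ) →
        |(t : ℝ) - OneChoice.criticalTime n lam| < 1 →
          1 - ε n ≤ (OneChoice.law n lam).real
            {ω | ∃ i : Fin n,
              c * (1 / (1 - (lam : ℝ)) * Real.log (n / (1 - (lam : ℝ)))) ≤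
                (OneChoice.load ω t i : ℝ)}) := by
  refine ⟨⟨1 / 128, by norm_num, OneChoice.failureBound, OneChoice.tendsto_failureBound,
    fun n lam t _ hlam hlam1 ht => OneChoice.le_prob_exists_heavy hlam hlam1 ht⟩, fun p => ?_⟩
  obtain ⟨N, hN⟩ := eventually_atTop.1 (OneChoice.eventually_log_div_le p)
  -- Dividing by deg p + 2 pays for the logarithm comparison; below N the bound 1 is vacuous.
  refine ⟨1 / 128 / (p.natDegree + 2), by positivity,
    fun n => if N ≤ n then OneChoice.failureBound n else 1, ?_, ?_⟩
  · refine OneChoice.tendsto_failureBound.congr' ?_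
    filter_upwards [eventually_ge_atTop N] with n hn
    simp [hn]
  · intro n lam t _ hp hlam hlamp ht
    have hpinv : 0 < 1 / p.eval (n : ℝ) := by positivity
    have hlam1 : (lam : ℝ) < 1 := by linarith
    have hd : 0 < 1 - (lam : ℝ) := by linarith
    dsimp only
    split_ifs with hn
    · refine (OneChoice.le_prob_exists_heavy hlam hlam1 ht).trans
        (measureReal_mono (fun ω => ?_) ?_)
      · rintro ⟨i, hi⟩
        refine ⟨i, le_trans ?_ hi⟩
        have h1 := hN n hn (1 - lam) hd (by
          rw [inv_le_comm₀ hd hp, ← one_div]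
          linarith)
        calc 1 / 128 / ((p.natDegree : ℝ) + 2) * (1 / (1 - (lam : ℝ)) *
              Real.log (n / (1 - (lam : ℝ))))
            ≤ 1 / 128 / ((p.natDegree : ℝ) + 2) * (1 / (1 - (lam : ℝ)) *
              ((p.natDegree + 2) * Real.log n)) := by gcongr
          _ = 1 / 128 * (1 / (1 - (lam : ℝ)) * Real.log n) := by field_simp
      · have : NeZero n := ⟨by omega⟩
        exact measure_ne_top _ _
    · simp
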